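/- All graphs are finite, undirected and simple. For a graph $G$ with vertex set $V(G)$ and $S\subseteq V(G)$, let $s(G\setminus S)$ be the number of connected components of the graph obtained from $G$ by deleting $S$. The graph $G$ is $t$-tough if $|S|\ge t\,s(G\setminus S)$ for every $S\subseteq V(G)$ with $s(G\setminus S)>1$; the toughness $\tau(G)$ is the maximum $t$ for which $G$ is $t$-tough, with $\tau(G)=\infty$ if $G$ is complete. Let $n$ be the number of vertices and $\delta$ the minimum degree of $G$, and call $G$ hamiltonian if it has a cycle through all its vertices. **Theorem 1.** Fix real numbers $a>0$ and $\varepsilon>0$. (i) There is an integer $N$, depending only on $a$ and $\varepsilon$, such that every graph $G$ with $n\ge N$, $\tau(G)\ge 1+\varepsilon$ and $\delta\ge \frac n2-a$ is hamiltonian. (ii) Explicitly, every graph $G$ with $n\ge 3$, $\tau(G)\ge 1+\varepsilon$, $\delta\ge\frac n2-a$ and $$n\ \ge\ \frac{4a-2}{\varepsilon}+2a-2$$ is hamiltonian. In particular, this applies to every graph with $\tau(G)>1$, taking $\varepsilon=\tau(G)-1$ if $\tau(G)$ is finite, and any $\varepsilon>0$ if $G$ is complete. -/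

import Mathlib

open scoped ENNReal

namespace SimpleGraph

/-- The number `s(G \ S)` of connected components of the graph obtained from the (finite) graph `G`
by deleting the vertices in `S`. It is `0` when no vertex is left. -/
noncomputable def numComponentsDelete {V : Type*} (G : SimpleGraph V) (S : Finset V) : ℕ :=
  Nat.card (G.induce ((S : Set V)ᶜ)).ConnectedComponent

/-- The finite graph `G` is `t`-tough: `|S| ≥ t * s(G \ S)` for every vertex set `S` with
`s(G \ S) > 1`. The value `t = ∞` is allowed; as `|S|` is finite, `G` is `∞`-tough exactly when
there is no such `S`, that is, when `G` is complete. -/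
def IsTough {V : Type*} (G : SimpleGraph V) (t : ℝ≥0∞) : Prop :=
  ∀ S : Finset V, 1 < G.numComponentsDelete S →
    t * (G.numComponentsDelete S : ℝ≥0∞) ≤ (S.card : ℝ≥0∞)

/-- The toughness of a finite graph: the largest `t` for which `G` is `t`-tough. It is `∞` for
complete graphs. -/
noncomputable def toughness {V : Type*} (G : SimpleGraph V) : ℝ≥0∞ :=
  sSup {t : ℝ≥0∞ | G.IsTough t}

end SimpleGraph

/-! ### Reachability and links inside a vertex set. -/

namespace SimpleGraph

/-! It suffices that n < (δ+1)(t+1) with t = 1+ε (`IsTough.isHamiltonian`). Suppose no cycle is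
spanning. Let r be least such that some cycle (edges count as cycles) leaves only components of
order at most r; among such cycles take one with fewest vertices in components of order r. Let H be
such a component and W the set of its k neighbours on the cycle. By minimality, a cycle meeting H
leaves some vertex of the old cycle in a component of order at least r (`exists_isUnimprovable`).

From each vertex of W, follow the cycle until the vertices passed, together with those off the
cycle, yield a component of order at least r that meets the path. This happens before the next
vertex of W, since otherwise a detour through H would improve the cycle. Crossing detours show that
these k components are pairwise remote (`IsUnimprovable.not_linkedThrough`); they are also remote
from H.

Toughness, applied to these k+1 sets, gives (k+1)(t+r) ≤ n; applied to H and the vertices outside H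
∪ W, it gives k ≥ 2t (`IsUnimprovable.card_bounds`). A vertex of H has all its neighbours in H ∪ W,
so δ+1 ≤ k+r. Hence (δ+1)(t+1) ≤ (k+r)(t+1) ≤ (k+1)(t+r) ≤ n, a contradiction. -/

/-- The spanning subgraph of `G` whose edges are those with both ends in `U`. -/
def restrictTo {V : Type*} (G : SimpleGraph V) (U : Set V) : SimpleGraph V where
  Adj a b := G.Adj a b ∧ a ∈ U ∧ b ∈ U
  symm := ⟨fun _ _ h => ⟨h.1.symm, h.2.2, h.2.1⟩⟩
  loopless := ⟨fun _ h => G.loopless.irrefl _ h.1⟩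

/-- The set of vertices that can be reached from `x` by walks of `G` inside `U`. -/
def reach {V : Type*} (G : SimpleGraph V) (U : Set V) (x : V) : Set V :=
  {y | (G.restrictTo U).Reachable x y}

/-- `x` and `y` are joined by a walk of `G` with at least one edge and with all inner vertices
in `U`. -/
def LinkedThrough {V : Type*} (G : SimpleGraph V) (U : Set V) (x y : V) : Prop :=
  G.Adj x y ∨ ∃ u ∈ U, ∃ w ∈ G.reach U u, G.Adj x u ∧ G.Adj w y

section reach

variable {V : Type*} {G : SimpleGraph V} {U U' : Set V} {x y z : V}

lemma mem_reach_self : x ∈ G.reach U x := Reachable.refl x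

lemma reach_mono (h : U ⊆ U') : G.reach U x ⊆ G.reach U' x := fun _ hy =>
  Reachable.mono (G := G.restrictTo U) (fun _ _ hab => ⟨hab.1, h hab.2.1, h hab.2.2⟩) hy

lemma mem_reach_comm : y ∈ G.reach U x ↔ x ∈ G.reach U y := ⟨Reachable.symm, Reachable.symm⟩

lemma mem_reach_trans (hy : y ∈ G.reach U x) (hz : z ∈ G.reach U y) : z ∈ G.reach U x :=
  Reachable.trans hy hz

lemma reach_eq_of_mem (hy : y ∈ G.reach U x) : G.reach U y = G.reach U x :=
  Set.ext fun _ => ⟨mem_reach_trans hy, mem_reach_trans (mem_reach_comm.1 hy)⟩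

lemma mem_reach_of_adj (hy : y ∈ G.reach U x) (hyU : y ∈ U) (hzU : z ∈ U) (h : G.Adj y z) :
    z ∈ G.reach U x :=
  Reachable.trans hy (Adj.reachable ⟨h, hyU, hzU⟩)

lemma reach_induction {p : V → Prop} (hx : p x)
    (step : ∀ y z, y ∈ G.reach U x → p y → y ∈ U → z ∈ U → G.Adj y z → p z) :
    ∀ y ∈ G.reach U x, p y := by
  intro y hy
  have hy' := (reachable_iff_reflTransGen _ _).1 hy
  induction hy' with
  | refl => exact hx
  | tail hab hbc ih =>
    have hb := (reachable_iff_reflTransGen _ _).2 hab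
    exact step _ _ hb (ih hb) hbc.2.1 hbc.2.2 hbc.1

lemma reach_subset (hx : x ∈ U) : G.reach U x ⊆ U :=
  reach_induction (p := (· ∈ U)) hx fun _ _ _ _ _ hz _ => hz

lemma exists_chain_of_mem_reach (hy : y ∈ G.reach U x) :
    ∃ q : List V, q ≠ [] ∧ q.Nodup ∧ (∀ u ∈ q, u ∈ G.reach U x) ∧
      ∀ a b, G.Adj a x → G.Adj y b → List.IsChain G.Adj (a :: q ++ [b]) := by
  obtain ⟨p, hp⟩ := Reachable.exists_isPath hy
  refine ⟨p.support, p.support_ne_nil, hp.support_nodup, fun u hu => ?_, fun a b ha hb => ?_⟩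
  · classical exact ⟨p.takeUntil u hu⟩
  · have h : List.IsChain G.Adj p.support := p.isChain_adj_support.imp fun _ _ h => h.1
    rw [List.cons_append, List.isChain_cons, List.isChain_append]
    refine ⟨?_, h, by simp, ?_⟩
    · intro c hc
      rw [List.head?_append_of_ne_nil _ p.support_ne_nil, List.head?_eq_some_head p.support_ne_nil,
        Option.mem_def, Option.some_inj, p.head_support] at hc
      exact hc ▸ ha
    · intro c hc d hd
      rw [List.getLast?_eq_some_getLast p.support_ne_nil, Option.mem_def, Option.some_inj,
        p.getLast_support] at hc
      simp only [List.head?_cons, Option.mem_def, Option.some_inj] at hd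
      exact hc ▸ hd ▸ hb

lemma LinkedThrough.symm (h : G.LinkedThrough U x y) : G.LinkedThrough U y x := by
  rcases h with h | ⟨u, hu, w, hw, hxu, hwy⟩
  · exact Or.inl h.symm
  · exact Or.inr ⟨w, reach_subset hu hw, u, mem_reach_comm.1 hw, hwy.symm, hxu.symm⟩

lemma LinkedThrough.exists_chain (h : G.LinkedThrough U x y) :
    ∃ q : List V, q.Nodup ∧ (∀ w ∈ q, w ∈ U ∧ ∃ u ∈ G.reach U w, G.Adj x u) ∧
      List.IsChain G.Adj (x :: q ++ [y]) := by
  rcases h with h | ⟨u, hu, w, hw, hxu, hwy⟩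
  · exact ⟨[], by simpa using h⟩
  · obtain ⟨q, -, hq, hqu, hc⟩ := exists_chain_of_mem_reach hw
    exact ⟨q, hq, fun c hc => ⟨reach_subset hu (hqu c hc), u, mem_reach_comm.1 (hqu c hc), hxu⟩,
      hc _ _ hxu hwy⟩

lemma mem_or_exists_adj_of_mem_reach_union {P : Set V} (hx : x ∈ P) :
    ∀ y ∈ G.reach (U ∪ P) x, y ∈ P ∨ ∃ a ∈ P, ∃ u ∈ U, G.Adj a u ∧ y ∈ G.reach U u := by
  refine reach_induction (Or.inl hx) fun y z _ hy hyU hzU h => ?_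
  rcases hzU with hzU | hzP
  · rcases hy with hy | ⟨a, ha, u, hu, hau, hy⟩
    · exact Or.inr ⟨y, hy, z, hzU, h, mem_reach_self⟩
    · exact Or.inr ⟨a, ha, u, hu, hau, mem_reach_of_adj hy (reach_subset hu hy) hzU h⟩
  · exact Or.inl hzP

lemma exists_linkedThrough_of_adj {P : Set V} (hx : x ∈ P) (hy : y ∈ G.reach (U ∪ P) x)
    (h : G.Adj y z) : ∃ a ∈ P, G.LinkedThrough U a z := by
  rcases mem_or_exists_adj_of_mem_reach_union hx y hy with hy | ⟨a, ha, u, hu, hau, hy⟩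
  · exact ⟨y, hy, Or.inl h⟩
  · exact ⟨a, ha, Or.inr ⟨u, hu, y, hy, hau, h⟩⟩

/-- The first edge of a walk entering `Q` would complete a link from its last vertex in `P`. -/
lemma reach_union_subset_of_not_linkedThrough {P Q : Set V} (hx : x ∈ P)
    (h : ∀ a ∈ P, ∀ b ∈ Q, ¬ G.LinkedThrough U a b) :
    G.reach (U ∪ P ∪ Q) x ⊆ G.reach (U ∪ P) x := by
  refine reach_induction mem_reach_self fun y z _ hy _ hzU hyz => ?_
  rcases hzU with hzU | hzQ
  · exact mem_reach_of_adj hy (reach_subset (Set.mem_union_right _ hx) hy) hzU hyz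
  · obtain ⟨a, ha, hl⟩ := exists_linkedThrough_of_adj hx hy hyz
    exact (h a ha z hzQ hl).elim

/-- Sets `P` and `Q` that are not linked through `U` have remote neighbourhoods in `U`. -/
lemma reach_union_remote {P Q : Set V} {a b : V} (hx : x ∈ P) (hy : y ∈ Q)
    (hPQ : Disjoint P Q) (hUQ : Disjoint U Q)
    (h : ∀ a ∈ P, ∀ b ∈ Q, ¬ G.LinkedThrough U a b)
    (ha : a ∈ G.reach (U ∪ P) x) (hb : b ∈ G.reach (U ∪ Q) y) : a ≠ b ∧ ¬ G.Adj a b := by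
  have hQ : U ∪ Q ⊆ U ∪ P ∪ Q := Set.union_subset_union_left _ Set.subset_union_left
  have key : b ∉ G.reach (U ∪ P ∪ Q) x := fun hb' => by
    have := reach_subset (Set.mem_union_right _ hx) (reach_union_subset_of_not_linkedThrough hx h
      (mem_reach_trans hb' (mem_reach_comm.1 (reach_mono hQ hb))))
    rcases this with h1 | h1
    · exact Set.disjoint_left.1 hUQ h1 hy
    · exact Set.disjoint_left.1 hPQ h1 hy
  have ha' := reach_mono (Set.subset_union_left (t := Q)) ha
  refine ⟨fun hab => key (hab ▸ ha'), fun hab => key (mem_reach_of_adj ha' ?_ ?_ hab)⟩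
  · exact Or.inl (reach_subset (Set.mem_union_right _ hx) ha)
  · exact hQ (reach_subset (Set.mem_union_right _ hy) hb)

end reach

/-! ### Toughness and families of remote sets. -/

section tough

variable {V : Type*} {G : SimpleGraph V}

/-- Each `S` bounds the supremum by |S| / s(G \ S), so the supremum is attained. -/
lemma isTough_of_le_toughness {t : ℝ≥0∞} (h : t ≤ G.toughness) : G.IsTough t := by
  intro S hS
  have h0 : (G.numComponentsDelete S : ℝ≥0∞) ≠ 0 := by
    exact_mod_cast (by omega : G.numComponentsDelete S ≠ 0)
  rw [← ENNReal.le_div_iff_mul_le (Or.inl h0) (Or.inl (ENNReal.natCast_ne_top _))]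
  refine h.trans (sSup_le fun s hs => ?_)
  rw [ENNReal.le_div_iff_mul_le (Or.inl h0) (Or.inl (ENNReal.natCast_ne_top _))]
  exact hs S hS

lemma IsTough.mul_le {t : ℝ} (ht : 0 ≤ t) (h : G.IsTough (ENNReal.ofReal t)) {S : Finset V}
    (hS : 1 < G.numComponentsDelete S) : t * G.numComponentsDelete S ≤ S.card := by
  have h1 := h S hS
  rw [← ENNReal.ofReal_natCast, ← ENNReal.ofReal_natCast, ← ENNReal.ofReal_mul ht] at h1
  exact (ENNReal.ofReal_le_ofReal_iff (Nat.cast_nonneg _)).1 h1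

/-- Pairwise remote nonempty vertex sets in a `t`-tough graph. -/
lemma IsTough.mul_card_add_sum_ncard_le [Fintype V] {t : ℝ} (ht : 0 ≤ t)
    (h : G.IsTough (ENNReal.ofReal t)) {ι : Type*} [Fintype ι] (hι : 1 < Fintype.card ι)
    (A : ι → Set V) (hne : ∀ i, (A i).Nonempty)
    (hA : ∀ i j, i ≠ j → ∀ a ∈ A i, ∀ b ∈ A j, a ≠ b ∧ ¬ G.Adj a b) :
    t * Fintype.card ι + ∑ i, ((A i).ncard : ℝ) ≤ Fintype.card V := by
  classical
  -- Exactly the union of the `A i` survives the deletion of `S`. No edge leaves an `A i`, so points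
  -- of different sets lie in different components; the `A i` need not be connected.
  set S : Finset V := Finset.univ.filter fun v => ∀ i, v ∉ A i with hSdef
  have hmem : ∀ v, v ∈ ((S : Set V)ᶜ) ↔ ∃ i, v ∈ A i := fun v => by simp [hSdef]
  choose a ha using hne
  let f : ι → (G.induce ((S : Set V)ᶜ)).ConnectedComponent := fun i =>
    (G.induce ((S : Set V)ᶜ)).connectedComponentMk ⟨a i, (hmem _).2 ⟨i, ha i⟩⟩
  have hf : Function.Injective f := by
    intro i j hij
    by_contra hne
    have hr := ConnectedComponent.exact hij
    have key : ∀ y, (G.induce ((S : Set V)ᶜ)).Reachable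
        ⟨a i, (hmem _).2 ⟨i, ha i⟩⟩ y → (y : V) ∈ A i := by
      intro y hy
      rw [reachable_iff_reflTransGen] at hy
      induction hy with
      | refl => exact ha i
      | @tail b c _ hbc ih =>
        obtain ⟨j, hj⟩ := (hmem _).1 c.2
        by_cases hji : i = j
        · exact hji ▸ hj
        · exact ((hA i j hji _ ih _ hj).2 hbc).elim
    exact (hA i j hne _ (key _ hr) _ (ha j)).1 rfl
  have hcard : Fintype.card ι ≤ G.numComponentsDelete S := by
    rw [← Nat.card_eq_fintype_card]
    exact Nat.card_le_card_of_injective f hf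
  have h1 := h.mul_le ht (S := S) (by omega)
  have h2 : S.card + ∑ i, (A i).ncard = Fintype.card V := by
    have h3 : ∑ i, (A i).ncard = Sᶜ.card := by
      have : Sᶜ = Finset.univ.biUnion fun i => (A i).toFinset := by
        ext v; simp [hSdef]
      rw [this, Finset.card_biUnion]
      · simp [Set.ncard_eq_toFinset_card']
      · intro i _ j _ hij
        rw [Function.onFun, Finset.disjoint_left]
        intro v hv hv'
        exact (hA i j hij v (by simpa using hv) v (by simpa using hv')).1 rfl
    rw [h3, Finset.card_add_card_compl]
  have h4 : (S.card : ℝ) + ∑ i, ((A i).ncard : ℝ) = Fintype.card V := by exact_mod_cast h2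
  have h5 : t * Fintype.card ι ≤ t * G.numComponentsDelete S :=
    mul_le_mul_of_nonneg_left (by exact_mod_cast hcard) ht
  linarith

end tough

/-! ### Rerouting an unimprovable cycle. -/

/-- The list `l` enumerates, in cyclic order, the vertices of a cycle of `G` or of an edge of `G`
(seen as a cycle of length two). -/
def IsCyclicList {V : Type*} (G : SimpleGraph V) (l : List V) : Prop :=
  2 ≤ l.length ∧ l.Nodup ∧ Cycle.Chain G.Adj (l : Cycle V)

/-- The vertices off the list `l`. -/
def offList {V : Type*} (l : List V) : Set V := {v | v ∉ l}

/-- `v` has a neighbour in the component of `u` in the graph without the vertices of `l`. -/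
def IsAttached {V : Type*} (G : SimpleGraph V) (l : List V) (u v : V) : Prop :=
  ∃ w ∈ G.reach (offList l) u, G.Adj v w

/-- Every cycle that meets the component of `u` off `l` leaves out a vertex of `l` that then lies
in a component with at least `h` vertices. -/
def IsUnimprovable {V : Type*} (G : SimpleGraph V) (l : List V) (u : V) (h : ℕ) : Prop :=
  ∀ l', G.IsCyclicList l' → (∃ w ∈ l', w ∈ G.reach (offList l) u) →
    ∃ z ∈ l, z ∉ l' ∧ h ≤ (G.reach (offList l') z).ncard

/-- Some component of `G` without the vertices of `l` other than those in `p` meets `p` and has at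
least `h` vertices. -/
def IsHeavy {V : Type*} (G : SimpleGraph V) (l : List V) (h : ℕ) (p : List V) : Prop :=
  ∃ z ∈ p, h ≤ (G.reach (offList l ∪ {v | v ∈ p}) z).ncard

section cycles

variable {V : Type*} {G : SimpleGraph V} {l l' : List V} {u v w x y z : V} {h : ℕ}

lemma IsCyclicList.isRotated (hl : G.IsCyclicList l) (hr : l ~r l') : G.IsCyclicList l' := by
  refine ⟨hr.perm.length_eq ▸ hl.1, hr.nodup_iff.1 hl.2.1, ?_⟩
  rw [← Cycle.coe_eq_coe.2 hr]
  exact hl.2.2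

lemma exists_isRotated_cons (hv : v ∈ l) : ∃ r, l ~r v :: r := by
  obtain ⟨a, b, rfl⟩ := List.append_of_mem hv
  exact ⟨b ++ a, by simpa using List.isRotated_append (l := a) (l' := v :: b)⟩

lemma eq_of_isRotated_cons {a b : List V} (hn : (v :: b).Nodup) (hr : v :: a ~r v :: b) :
    a = b := by
  have hn' := hr.nodup_iff.2 hn
  obtain ⟨n, hn1, hn2⟩ := List.isRotated_iff_mod.1 hr
  rcases hn1.lt_or_eq with h | h
  · have h1 := congrArg List.head? hn2
    rw [List.head?_rotate h, List.head?_cons] at h1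
    have h2 : n = 0 := by
      rw [List.getElem?_eq_getElem h, Option.some_inj] at h1
      exact (hn'.getElem_inj_iff (i := n) (j := 0) (hi := h) (hj := by simp)).1 (by simpa using h1)
    subst h2
    simpa using hn2
  · rw [h, List.rotate_length] at hn2
    simpa using hn2

lemma reach_subset_offList (hu : u ∉ l) : G.reach (offList l) u ⊆ offList l := reach_subset hu

/-- If the vertices between two attached vertices were not heavy, the cycle could be rerouted. -/
lemma IsUnimprovable.isHeavy_gap [Finite V] (hI : G.IsUnimprovable l u h) (hu : u ∉ l)
    (hl : G.IsCyclicList l) {p s : List V} (hr : l ~r v :: p ++ w :: s)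
    (hv : G.IsAttached l u v) (hw : G.IsAttached l u w) : G.IsHeavy l h p := by
  obtain ⟨a, ha, hva⟩ := hv
  obtain ⟨b, hb, hwb⟩ := hw
  rw [← reach_eq_of_mem ha] at hb
  obtain ⟨q, hq0, hqn, hq, hc⟩ := exists_chain_of_mem_reach hb
  replace hc := hc _ _ hva hwb.symm
  rw [reach_eq_of_mem ha] at hq
  obtain ⟨-, hn, hch⟩ := hl.isRotated hr
  obtain ⟨c, hcq⟩ := List.exists_mem_of_ne_nil q hq0
  have hmem : ∀ x, x ∈ l ↔ x ∈ v :: p ++ w :: s := fun x => hr.mem_iff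
  have hqoff : ∀ x ∈ q, x ∉ v :: p ++ w :: s := fun x hx hx' =>
    reach_subset_offList hu (hq x hx) ((hmem x).2 hx')
  have hl' : G.IsCyclicList (v :: q ++ w :: s) := by
    refine ⟨by simp; omega, ?_, ?_⟩
    · grind
    · rw [List.cons_append, Cycle.chain_coe_cons] at hch ⊢
      have e1 : ∀ p : List V, v :: (p ++ w :: s ++ [v]) = (v :: p) ++ w :: (s ++ [v]) := by simp
      rw [e1, List.isChain_split] at hch ⊢
      exact ⟨hc, hch.2⟩
  obtain ⟨z, hzl, hz, hzh⟩ := hI _ hl' ⟨c, by simp [hcq], hq c hcq⟩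
  refine ⟨z, by grind, hzh.trans (Set.ncard_le_ncard (reach_mono fun x hx => ?_))⟩
  simp only [offList, Set.mem_ofPred_eq, Set.mem_union] at hx ⊢
  grind

/-- The new cycle goes from `v` through the component of `u` to `w`, back along `r` to `x`, across
to `y` and on along `s`. From `l` it omits only `p₁` and `p₂`; if these are not linked, the large
component left behind meets only one of them. -/
lemma IsUnimprovable.isHeavy_or_linked [Finite V] (hI : G.IsUnimprovable l u h) (hu : u ∉ l)
    (hl : G.IsCyclicList l) {p₁ r p₂ s : List V}
    (hr : l ~r v :: p₁ ++ x :: r ++ w :: p₂ ++ y :: s)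
    (hv : G.IsAttached l u v) (hw : G.IsAttached l u w) (hx : ¬ G.IsAttached l u x)
    (hxy : G.LinkedThrough (offList l) x y) :
    G.IsHeavy l h p₁ ∨ G.IsHeavy l h p₂ ∨
      ∃ a ∈ p₁, ∃ b ∈ p₂, G.LinkedThrough (offList l) a b := by
  obtain ⟨a, ha, hva⟩ := hv
  obtain ⟨b, hb, hwb⟩ := hw
  rw [← reach_eq_of_mem ha] at hb
  obtain ⟨q, hq0, hqn, hq, hc⟩ := exists_chain_of_mem_reach hb
  replace hc := hc _ _ hva hwb.symm
  rw [reach_eq_of_mem ha] at hq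
  obtain ⟨q', hqn', hq', hc'⟩ := hxy.exists_chain
  obtain ⟨-, hn, hch⟩ := hl.isRotated hr
  obtain ⟨c, hcq⟩ := List.exists_mem_of_ne_nil q hq0
  have hmem : ∀ z, z ∈ l ↔ z ∈ v :: p₁ ++ x :: r ++ w :: p₂ ++ y :: s := fun z => hr.mem_iff
  have hqoff : ∀ z ∈ q, z ∉ v :: p₁ ++ x :: r ++ w :: p₂ ++ y :: s := fun z hz hz' =>
    reach_subset_offList hu (hq z hz) ((hmem z).2 hz')
  have hqoff' : ∀ z ∈ q', z ∉ v :: p₁ ++ x :: r ++ w :: p₂ ++ y :: s := fun z hz hz' =>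
    (hq' z hz).1 ((hmem z).2 hz')
  -- As `x` is not attached, the link from `x` to `y` avoids the component of `u`.
  have hqq' : ∀ z ∈ q, z ∉ q' := fun z hz hz' => by
    obtain ⟨c, hc, hxc⟩ := (hq' z hz').2
    exact hx ⟨c, reach_eq_of_mem (hq z hz) ▸ hc, hxc⟩
  have hl' : G.IsCyclicList (v :: q ++ w :: r.reverse ++ x :: q' ++ y :: s) := by
    refine ⟨by simp; omega, ?_, ?_⟩
    · classical
      rw [List.nodup_iff_count_le_one] at hn hqn hqn' ⊢
      intro z
      have h1 := hn z
      have h2 := hqn z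
      have h3 := hqn' z
      have h4 : z ∈ q → List.count z (v :: p₁ ++ x :: r ++ w :: p₂ ++ y :: s) = 0 :=
        fun hz => List.count_eq_zero.2 (hqoff z hz)
      have h5 : z ∈ q' → List.count z (v :: p₁ ++ x :: r ++ w :: p₂ ++ y :: s) = 0 :=
        fun hz => List.count_eq_zero.2 (hqoff' z hz)
      have h6 : z ∈ q → List.count z q' = 0 := fun hz => List.count_eq_zero.2 (hqq' z hz)
      rw [← List.count_pos_iff] at h4 h5 h6
      simp only [List.count_append, List.count_cons, List.count_reverse] at h1 h4 h5 ⊢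
      omega
    · have e1 : v :: p₁ ++ x :: r ++ w :: p₂ ++ y :: s =
        v :: (p₁ ++ x :: r ++ w :: p₂ ++ y :: s) := by simp
      have e2 : v :: q ++ w :: r.reverse ++ x :: q' ++ y :: s =
        v :: (q ++ w :: r.reverse ++ x :: q' ++ y :: s) := by simp
      rw [e1, Cycle.chain_coe_cons] at hch
      rw [e2, Cycle.chain_coe_cons]
      have e3 : v :: (p₁ ++ x :: r ++ w :: p₂ ++ y :: s ++ [v]) =
        (v :: p₁) ++ x :: (r ++ w :: (p₂ ++ y :: (s ++ [v]))) := by simp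
      have e4 : v :: (q ++ w :: r.reverse ++ x :: q' ++ y :: s ++ [v]) =
        (v :: q) ++ w :: (r.reverse ++ x :: (q' ++ y :: (s ++ [v]))) := by simp
      rw [e3] at hch
      have hch₁ := (List.isChain_split (l₁ := x :: r)).1 (List.isChain_split.1 hch).2
      have hch₂ := ((List.isChain_split (l₁ := w :: p₂)).1 hch₁.2).2
      rw [e4]
      refine List.isChain_split.2 ⟨hc, (List.isChain_split (l₁ := w :: r.reverse)).2 ⟨?_,
        (List.isChain_split (l₁ := x :: q')).2 ⟨hc', hch₂⟩⟩⟩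
      have e5 : w :: r.reverse ++ [x] = (x :: r ++ [w]).reverse := by simp
      rw [e5, List.isChain_reverse]
      exact hch₁.1.imp fun _ _ h => h.symm
  obtain ⟨z, hzl, hz, hzh⟩ := hI _ hl' ⟨c, by simp [hcq], hq c hcq⟩
  by_cases hlink : ∃ a ∈ p₁, ∃ b ∈ p₂, G.LinkedThrough (offList l) a b
  · exact Or.inr (Or.inr hlink)
  push Not at hlink
  have hoff : offList (v :: q ++ w :: r.reverse ++ x :: q' ++ y :: s) ⊆
      offList l ∪ {v | v ∈ p₁} ∪ {v | v ∈ p₂} := fun z hz => by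
    simp only [offList, Set.mem_ofPred_eq, Set.mem_union] at hz ⊢
    grind
  have hz' : z ∈ p₁ ∨ z ∈ p₂ := by grind
  rcases hz' with hz' | hz'
  · refine Or.inl ⟨z, hz', hzh.trans (Set.ncard_le_ncard ((reach_mono hoff).trans ?_))⟩
    exact reach_union_subset_of_not_linkedThrough hz' hlink
  · refine Or.inr (Or.inl ⟨z, hz', hzh.trans (Set.ncard_le_ncard ((reach_mono hoff).trans ?_))⟩)
    rw [Set.union_right_comm]
    exact reach_union_subset_of_not_linkedThrough hz' fun a ha b hb hab => hlink b hb a ha hab.symm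

/-- `p` is a shortest heavy path that follows the attached vertex `v` on the cycle `l`. -/
structure IsMinHeavyPrefix (G : SimpleGraph V) (l : List V) (u : V) (h : ℕ) (v : V) (p : List V) :
    Prop where
  isRotated : ∃ s, l ~r v :: p ++ s
  not_isAttached : ∀ x ∈ p, ¬ G.IsAttached l u x
  isHeavy : G.IsHeavy l h p
  not_isHeavy : ∀ q x t, p = q ++ x :: t → ¬ G.IsHeavy l h q

/-- The whole gap up to the next attached vertex is heavy by `isHeavy_gap`, so it has a shortest
heavy initial segment. -/
lemma IsUnimprovable.exists_isMinHeavyPrefix [Finite V] (hI : G.IsUnimprovable l u h)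
    (hu : u ∉ l) (hl : G.IsCyclicList l) (hvl : v ∈ l) (hwl : w ∈ l) (hvw : v ≠ w)
    (hv : G.IsAttached l u v) (hw : G.IsAttached l u w) :
    ∃ p, G.IsMinHeavyPrefix l u h v p := by
  classical
  obtain ⟨t, ht⟩ := exists_isRotated_cons hvl
  have hwt : w ∈ t := by
    have := ht.mem_iff.1 hwl
    grind
  set f : V → Bool := fun x => decide (¬ G.IsAttached l u x) with hf
  have hne : t.dropWhile f ≠ [] := by
    intro h0
    have := (List.dropWhile_eq_nil_iff.1 h0) w hwt
    simp [hf] at this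
    exact this hw
  obtain ⟨w', s, hs⟩ := List.exists_cons_of_ne_nil hne
  have hw' : G.IsAttached l u w' := by
    have h1 := List.head_dropWhile_not f hne
    have h2 : (t.dropWhile f).head hne = w' := by simp [hs]
    rw [h2] at h1
    simpa [hf] using h1
  have hts : t = t.takeWhile f ++ w' :: s := by
    rw [← hs, List.takeWhile_append_dropWhile]
  have hna : ∀ x ∈ t.takeWhile f, ¬ G.IsAttached l u x := fun x hx => by
    simpa [hf] using List.mem_takeWhile_imp hx
  have hgap : G.IsHeavy l h (t.takeWhile f) := by
    refine hI.isHeavy_gap hu hl (v := v) (w := w') (s := s) ?_ hv hw'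
    rw [List.cons_append, ← hts]
    exact ht
  have hex : ∃ n, G.IsHeavy l h ((t.takeWhile f).take n) :=
    ⟨(t.takeWhile f).length, by rwa [List.take_length]⟩
  refine ⟨(t.takeWhile f).take (Nat.find hex), ⟨(t.takeWhile f).drop (Nat.find hex) ++ w' :: s, ?_⟩,
    fun x hx => hna x (List.mem_of_mem_take hx), Nat.find_spec hex, ?_⟩
  · rwa [List.cons_append, ← List.append_assoc, List.take_append_drop, ← hts]
  · intro q x t' hq hq'
    have hlen : q.length < Nat.find hex := by
      have := congrArg List.length hq
      simp at this
      omega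
    refine Nat.find_min hex hlen ?_
    have : q = ((t.takeWhile f).take (Nat.find hex)).take q.length := by rw [hq]; simp
    rw [List.take_take, min_eq_left hlen.le] at this
    rwa [← this]

/-- Neither path contains an attached vertex, so each ends before the other one's starting vertex.
-/
lemma IsMinHeavyPrefix.exists_isRotated_append (hl : l.Nodup) {p p' : List V}
    (hp : G.IsMinHeavyPrefix l u h v p) (hp' : G.IsMinHeavyPrefix l u h w p')
    (hwl : w ∈ l) (hvw : v ≠ w) (hv : G.IsAttached l u v) (hw : G.IsAttached l u w) :
    ∃ r s, l ~r v :: p ++ r ++ w :: p' ++ s := by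
  obtain ⟨t, ht⟩ := hp.isRotated
  obtain ⟨t', ht'⟩ := hp'.isRotated
  have hwt : w ∈ t := by
    have h1 := ht.mem_iff.1 hwl
    have h2 := hp.not_isAttached w
    grind
  obtain ⟨r, s, rfl⟩ := List.append_of_mem hwt
  have h1 : w :: s ++ (v :: p ++ r) ~r w :: p' ++ t' := by
    refine List.IsRotated.trans ?_ (ht.symm.trans ht')
    simpa using List.isRotated_append (l := w :: s) (l' := v :: p ++ r)
  have h2 : s ++ (v :: p ++ r) = p' ++ t' := by
    exact eq_of_isRotated_cons (ht'.nodup_iff.1 hl) h1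
  have h3 : ∃ s', s = p' ++ s' := by
    rcases List.append_eq_append_iff.1 h2 with ⟨c, hc, hc'⟩ | ⟨c, hc, -⟩
    · rcases c with - | ⟨d, c⟩
      · exact ⟨[], by simpa using hc.symm⟩
      · exfalso
        refine hp'.not_isAttached v ?_ hv
        have hd : d = v := by simpa using (congrArg List.head? hc').symm
        simp [hc, hd]
    · exact ⟨c, hc⟩
  obtain ⟨s', rfl⟩ := h3
  exact ⟨r, s', by simpa using ht⟩

/-- Descent on the number of vertices preceding `x` and `y`: rerouting yields either a heavy proper
prefix, against minimality, or a linked pair nearer to the starts. -/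
lemma IsUnimprovable.not_linkedThrough [Finite V] (hI : G.IsUnimprovable l u h)
    (hu : u ∉ l) (hl : G.IsCyclicList l) {p p' : List V}
    (hp : G.IsMinHeavyPrefix l u h v p) (hp' : G.IsMinHeavyPrefix l u h w p')
    (hwl : w ∈ l) (hvw : v ≠ w) (hv : G.IsAttached l u v) (hw : G.IsAttached l u w) :
    ∀ x ∈ p, ∀ y ∈ p', ¬ G.LinkedThrough (offList l) x y := by
  obtain ⟨r, s, hr⟩ := hp.exists_isRotated_append hl.2.1 hp' hwl hvw hv hw
  have key : ∀ n q x t q' y t', q.length + q'.length = n → p = q ++ x :: t → p' = q' ++ y :: t' →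
      ¬ G.LinkedThrough (offList l) x y := by
    intro n
    induction n using Nat.strong_induction_on with
    | _ n ih =>
    rintro q x t q' y t' rfl rfl rfl hxy
    have hr' : l ~r v :: q ++ x :: (t ++ r) ++ w :: q' ++ y :: (t' ++ s) := by simpa using hr
    rcases hI.isHeavy_or_linked hu hl hr' hv hw (hp.not_isAttached x (by simp)) hxy with
      h1 | h1 | ⟨a, ha, b, hb, hab⟩
    · exact hp.not_isHeavy q x t rfl h1
    · exact hp'.not_isHeavy q' y t' rfl h1
    · obtain ⟨q₁, q₂, rfl⟩ := List.append_of_mem ha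
      obtain ⟨q₃, q₄, rfl⟩ := List.append_of_mem hb
      exact ih (q₁.length + q₃.length) (by simp; omega) q₁ a (q₂ ++ x :: t) q₃ b (q₄ ++ y :: t')
        rfl (by simp) (by simp) hab
  intro x hx y hy
  obtain ⟨q₁, q₂, rfl⟩ := List.append_of_mem hx
  obtain ⟨q₃, q₄, rfl⟩ := List.append_of_mem hy
  exact key _ q₁ x q₂ q₃ y q₄ rfl rfl rfl

end cycles

/-! ### Counting, and the extremal choice of the cycle. -/

section count

variable {V : Type*} {G : SimpleGraph V} {l : List V} {u v : V} {h : ℕ} {t : ℝ}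

lemma mem_reach_offList_of_adj (hu : u ∉ l) {a b : V} (ha : a ∈ G.reach (offList l) u)
    (hb : ¬ G.IsAttached l u b) (hab : G.Adj a b) : b ∈ G.reach (offList l) u := by
  by_cases hbl : b ∈ l
  · exact (hb ⟨a, ha, hab.symm⟩).elim
  · exact mem_reach_of_adj ha (reach_subset_offList hu ha) hbl hab

lemma reach_offList_union_subset (hu : u ∉ l) {p : List V}
    (hp : ∀ x ∈ p, ¬ G.IsAttached l u x) :
    G.reach (offList l ∪ {v | v ∈ p}) u ⊆ G.reach (offList l) u := by
  refine reach_induction mem_reach_self fun y z _ hy _ hzU hyz => ?_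
  rcases hzU with hz | hz
  · exact mem_reach_of_adj hy (reach_subset_offList hu hy) hz hyz
  · exact mem_reach_offList_of_adj hu hy (hp z hz) hyz

/-- The number of attached vertices is at least twice the toughness, unless all vertices of `l`
are attached. -/
lemma IsTough.two_mul_le_ncard [Fintype V] (ht : 0 ≤ t) (hG : G.IsTough (ENNReal.ofReal t))
    (hu : u ∉ l) (hv : v ∈ l) (hvu : ¬ G.IsAttached l u v) :
    t * 2 ≤ ({v | v ∈ l ∧ G.IsAttached l u v} : Set V).ncard := by
  set W : Set V := {v | v ∈ l ∧ G.IsAttached l u v} with hW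
  set H := G.reach (offList l) u with hH
  have hWH : Disjoint W H := Set.disjoint_left.2 fun x hx hx' => reach_subset_offList hu hx' hx.1
  have hrem : ∀ a ∈ H, ∀ b ∈ (W ∪ H)ᶜ, a ≠ b ∧ ¬ G.Adj a b := by
    intro a ha b hb
    refine ⟨fun hab => hb (Or.inr (hab ▸ ha)), fun hab => ?_⟩
    by_cases hbl : b ∈ l
    · exact hb (Or.inl ⟨hbl, a, ha, hab.symm⟩)
    · exact hb (Or.inr (mem_reach_of_adj ha (reach_subset_offList hu ha) hbl hab))
  -- The complement of these two remote sets is `W`; the second contains `v`.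
  have h1 := hG.mul_card_add_sum_ncard_le ht (ι := Bool) (by simp)
    (fun b => if b then H else (W ∪ H)ᶜ) ?_ ?_
  · have h2 := Set.ncard_add_ncard_compl (W ∪ H)
    rw [Set.ncard_union_eq hWH, Nat.card_eq_fintype_card] at h2
    have h3 : ((W.ncard : ℝ) + H.ncard) + (W ∪ H)ᶜ.ncard = Fintype.card V := by exact_mod_cast h2
    simp only [Fintype.card_bool, Fintype.sum_bool, if_true, Bool.false_eq_true, if_false] at h1
    push_cast at h1
    linarith
  · rintro (_ | _)
    · refine ⟨v, fun hvWH => ?_⟩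
      rcases hvWH with h | h
      · exact hvu h.2
      · exact reach_subset_offList hu h hv
    · exact ⟨u, mem_reach_self⟩
  · rintro (_ | _) (_ | _) hij a ha b hb
    · exact (hij rfl).elim
    · have := hrem b hb a ha
      exact ⟨this.1.symm, fun h => this.2 h.symm⟩
    · exact hrem a ha b hb
    · exact (hij rfl).elim

lemma minDegree_lt_ncard_add_ncard [Fintype V] [DecidableRel G.Adj] (hu : u ∉ l) :
    G.minDegree + 1 ≤ ({v | v ∈ l ∧ G.IsAttached l u v} : Set V).ncard +
      (G.reach (offList l) u).ncard := by
  classical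
  set W : Set V := {v | v ∈ l ∧ G.IsAttached l u v}
  have h1 : ((insert u (G.neighborFinset u) : Finset V) : Set V) ⊆
      W ∪ G.reach (offList l) u := by
    intro x hx
    simp only [Finset.coe_insert, Set.mem_insert_iff, Finset.mem_coe, mem_neighborFinset] at hx
    rcases hx with rfl | hx
    · exact Or.inr mem_reach_self
    · by_cases hxl : x ∈ l
      · exact Or.inl ⟨hxl, u, mem_reach_self, hx.symm⟩
      · exact Or.inr (mem_reach_of_adj mem_reach_self hu hxl hx)
  have h2 := Set.ncard_le_ncard h1
  rw [Set.ncard_coe_finset, Finset.card_insert_of_notMem (by simp), card_neighborFinset_eq_degree]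
    at h2
  have h3 := Set.ncard_union_le W (G.reach (offList l) u)
  have h4 := G.minDegree_le_degree u
  omega

lemma IsUnimprovable.card_bounds [Fintype V] (ht : 1 < t) (hG : G.IsTough (ENNReal.ofReal t))
    (hl : G.IsCyclicList l) (hu : u ∉ l)
    (hI : G.IsUnimprovable l u (G.reach (offList l) u).ncard) :
    let k := ({v | v ∈ l ∧ G.IsAttached l u v} : Set V).ncard
    t * 2 ≤ k ∧ (t + (G.reach (offList l) u).ncard) * (k + 1) ≤ Fintype.card V := by
  classical
  have ht0 : 0 ≤ t := by linarith
  intro k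
  set h := (G.reach (offList l) u).ncard with hh
  set W : Set V := {v | v ∈ l ∧ G.IsAttached l u v} with hW
  -- Heavy paths exist only if there are two attached vertices, so this comes first. Their vertices
  -- are not attached, which then gives the bound `t * 2 ≤ k` in every case.
  have hk : 1 < k := by
    by_cases hall : ∀ v ∈ l, G.IsAttached l u v
    · have : W = (l.toFinset : Set V) := by
        ext v
        simpa [hW] using hall v
      change 1 < W.ncard
      rw [this, Set.ncard_coe_finset, List.toFinset_card_of_nodup hl.2.1]
      exact hl.1
    · push Not at hall
      obtain ⟨v, hv, hvu⟩ := hall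
      have h1 := hG.two_mul_le_ncard ht0 hu hv hvu
      have h2 : (1 : ℝ) < k := by linarith
      exact_mod_cast h2
  have hex : ∀ v : W, ∃ p, G.IsMinHeavyPrefix l u h v p := by
    intro v
    obtain ⟨w, hw, hwv⟩ := Set.exists_ne_of_one_lt_ncard hk v
    exact hI.exists_isMinHeavyPrefix hu hl v.2.1 hw.1 hwv.symm v.2.2 hw.2
  choose p hp using hex
  have hpl : ∀ v, ∀ x ∈ p v, x ∈ l := by
    intro v x hx
    obtain ⟨s, hs⟩ := (hp v).isRotated
    exact hs.mem_iff.2 (by simp [hx])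
  choose z hz hzh using fun v => (hp v).isHeavy
  have hk2 : t * 2 ≤ k := by
    obtain ⟨v, hv⟩ : W.Nonempty := Set.nonempty_of_ncard_ne_zero (by change k ≠ 0; omega)
    exact hG.two_mul_le_ncard ht0 hu (hpl ⟨v, hv⟩ _ (hz _)) ((hp ⟨v, hv⟩).not_isAttached _ (hz _))
  refine ⟨hk2, ?_⟩
  set A : Option W → Set V := fun o => o.elim (G.reach (offList l) u)
    fun v => G.reach (offList l ∪ {x | x ∈ p v}) (z v) with hA
  have hcard : Fintype.card (Option W) = k + 1 := by
    rw [Fintype.card_option, ← Nat.card_eq_fintype_card]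
    rfl
  have hoff : ∀ v, Disjoint (offList l) {x | x ∈ p v} := fun v =>
    Set.disjoint_left.2 fun x hx hx' => hx (hpl v x hx')
  have hremH : ∀ v, ∀ a ∈ A none, ∀ b ∈ A (some v), a ≠ b ∧ ¬ G.Adj a b := by
    intro v a ha b hb
    have hsub := reach_offList_union_subset hu (hp v).not_isAttached
    have ha' : a ∈ G.reach (offList l ∪ {x | x ∈ p v}) u := reach_mono Set.subset_union_left ha
    have key : b ∉ G.reach (offList l ∪ {x | x ∈ p v}) u := fun hb' =>
      reach_subset_offList hu (hsub (mem_reach_trans hb' (mem_reach_comm.1 hb))) (hpl v _ (hz v))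
    refine ⟨fun hab => key (hab ▸ ha'), fun hab => key (mem_reach_of_adj ha' ?_ ?_ hab)⟩
    · exact Or.inl (reach_subset_offList hu ha)
    · exact reach_subset (U := offList l ∪ {x | x ∈ p v}) (Set.mem_union_right _ (hz v)) hb
  have hrem : ∀ i j, i ≠ j → ∀ a ∈ A i, ∀ b ∈ A j, a ≠ b ∧ ¬ G.Adj a b := by
    rintro (_ | v) (_ | w) hij a ha b hb
    · exact (hij rfl).elim
    · exact hremH w a ha b hb
    · have := hremH v b hb a ha
      exact ⟨this.1.symm, fun h => this.2 h.symm⟩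
    · have hvw : (v : V) ≠ w := fun h => hij (congrArg some (Subtype.ext h))
      refine reach_union_remote (hz v) (hz w) ?_ (hoff w)
        (hI.not_linkedThrough hu hl (hp v) (hp w) w.2.1 hvw v.2.2 w.2.2) ha hb
      obtain ⟨r, s, hr⟩ :=
        (hp v).exists_isRotated_append hl.2.1 (hp w) w.2.1 hvw v.2.2 w.2.2
      have hn := hr.nodup_iff.1 hl.2.1
      refine Set.disjoint_left.2 fun x hx hx' => ?_
      have hx1 : x ∈ p v := hx
      have hx2 : x ∈ p w := hx'
      grind
  have hmain := hG.mul_card_add_sum_ncard_le ht0 (ι := Option W) (by omega) A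
    (by
      rintro (_ | v)
      · exact ⟨u, mem_reach_self⟩
      · exact ⟨z v, mem_reach_self⟩) hrem
  have hsum : (Fintype.card (Option W) : ℝ) * h ≤ ∑ i, ((A i).ncard : ℝ) := by
    rw [← nsmul_eq_mul, ← Finset.card_univ]
    refine Finset.card_nsmul_le_sum _ _ _ ?_
    rintro (_ | v) -
    · exact le_rfl
    · exact_mod_cast hzh v
  rw [hcard] at hmain hsum
  push_cast at hmain hsum
  linarith

lemma IsTough.exists_adj [Fintype V] (ht : 0 < t) (hG : G.IsTough (ENNReal.ofReal t))
    (hV : 1 < Fintype.card V) : ∃ a b, G.Adj a b := by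
  by_contra hne
  push Not at hne
  obtain ⟨a, b, hab⟩ := Fintype.one_lt_card_iff.1 hV
  have h1 := hG.mul_card_add_sum_ncard_le ht.le (ι := Bool) (by simp)
    (fun i => if i then {a} else {a}ᶜ) ?_ ?_
  · have h2 := Set.ncard_add_ncard_compl ({a} : Set V)
    rw [Nat.card_eq_fintype_card] at h2
    have h3 : ((({a} : Set V).ncard : ℝ)) + ({a} : Set V)ᶜ.ncard = Fintype.card V := by
      exact_mod_cast h2
    simp only [Fintype.card_bool, Fintype.sum_bool, if_true, Bool.false_eq_true, if_false] at h1
    push_cast at h1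
    linarith
  · rintro (_ | _)
    · exact ⟨b, by simpa using hab.symm⟩
    · exact ⟨a, by simp⟩
  · rintro (_ | _) (_ | _) hij x hx y hy
    · exact (hij rfl).elim
    · exact ⟨fun h => hx (h ▸ hy), hne x y⟩
    · exact ⟨fun h => hy (h ▸ hx), hne x y⟩
    · exact (hij rfl).elim

/-- A cyclic list that minimises the number of vertices in components of maximal order `h` off the
list is unimprovable. -/
lemma exists_isUnimprovable [Finite V] (h : ℕ)
    (hex : ∃ l, G.IsCyclicList l ∧ ∀ z ∉ l, (G.reach (offList l) z).ncard ≤ h + 1)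
    (hno : ¬ ∃ l, G.IsCyclicList l ∧ ∀ z ∉ l, (G.reach (offList l) z).ncard ≤ h) :
    ∃ l u, G.IsCyclicList l ∧ u ∉ l ∧ G.IsUnimprovable l u (G.reach (offList l) u).ncard := by
  obtain ⟨l, ⟨hl, hlh⟩, hmin⟩ := (measure fun l : List V =>
    {z | z ∉ l ∧ h + 1 ≤ (G.reach (offList l) z).ncard}.ncard).wf.has_min
      {l | G.IsCyclicList l ∧ ∀ z ∉ l, (G.reach (offList l) z).ncard ≤ h + 1} hex
  have : ∃ u ∉ l, h + 1 ≤ (G.reach (offList l) u).ncard := by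
    by_contra hc
    push Not at hc
    exact hno ⟨l, hl, fun z hz => Nat.lt_succ_iff.1 (hc z hz)⟩
  obtain ⟨u, hu, huh⟩ := this
  have hueq : (G.reach (offList l) u).ncard = h + 1 := le_antisymm (hlh u hu) huh
  refine ⟨l, u, hl, hu, ?_⟩
  rw [hueq]
  rintro l' hl' ⟨w, hwl', hw⟩
  by_contra hc
  push Not at hc
  -- By `hc`, a component off `l'` of order above `h` avoids `l`, so it lies inside a component off
  -- `l`.
  have hsub : ∀ z ∉ l', h + 1 ≤ (G.reach (offList l') z).ncard →
      G.reach (offList l') z ⊆ G.reach (offList l) z := by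
    intro z hz hzh
    have hoff : ∀ y ∈ G.reach (offList l') z, y ∉ l := fun y hy hyl => by
      have := hc y hyl (reach_subset hz hy)
      rw [reach_eq_of_mem hy] at this
      omega
    refine reach_induction mem_reach_self fun a b ha' ha haU hbU hab => ?_
    exact mem_reach_of_adj ha (hoff a ha')
      (hoff b (mem_reach_of_adj ha' haU hbU hab)) hab
  have hoffl : ∀ z ∉ l', h + 1 ≤ (G.reach (offList l') z).ncard → z ∉ l := fun z hz hzh hzl => by
    have := hc z hzl hz
    omega
  refine hmin l' ⟨hl', fun z hz => ?_⟩ ?_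
  · by_contra hlt
    push Not at hlt
    have h1 := Set.ncard_le_ncard (hsub z hz hlt.le)
    have h2 := hlh z (hoffl z hz hlt.le)
    omega
  · refine Set.ncard_lt_ncard ((Set.ssubset_iff_of_subset ?_).2 ⟨w, ⟨?_, ?_⟩, fun h => h.1 hwl'⟩)
    · rintro z ⟨hz, hzh⟩
      exact ⟨hoffl z hz hzh, hzh.trans (Set.ncard_le_ncard (hsub z hz hzh))⟩
    · exact reach_subset_offList hu hw
    · rw [reach_eq_of_mem hw]
      exact huh

lemma IsCyclicList.isHamiltonian [Fintype V] [DecidableEq V] (hl : G.IsCyclicList l)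
    (hV : 3 ≤ Fintype.card V) (hall : ∀ v, v ∈ l) : G.IsHamiltonian := by
  obtain ⟨-, hn, hc⟩ := hl
  rcases l with - | ⟨a, m⟩
  · have := Fintype.card_pos_iff.1 (by omega : 0 < Fintype.card V)
    exact absurd (hall this.some) (by simp)
  rw [Cycle.chain_coe_cons] at hc
  have hlen : (a :: m).length = Fintype.card V := by
    rw [← List.toFinset_card_of_nodup hn, ← Finset.card_univ]
    congr 1
    ext v
    simpa using hall v
  have hex : ∃ p : G.Walk a a, p.support = a :: (m ++ [a]) :=
    ⟨(Walk.ofSupport _ (List.cons_ne_nil _ _) hc).copy (by simp) (by simp),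
      (Walk.support_copy _ _ _).trans (Walk.support_ofSupport _ _)⟩
  obtain ⟨p, hp⟩ := hex
  have hplen : p.length = Fintype.card V := by
    have := p.length_support
    rw [hp] at this
    simp at this hlen
    omega
  have hcount : ∀ v, p.support.tail.count v = 1 := by
    intro v
    rw [hp, List.tail_cons]
    have h1 : (m ++ [a]).Perm (a :: m) := List.perm_append_singleton a m
    rw [h1.count_eq]
    exact List.count_eq_one_of_mem hn (hall v)
  intro _
  refine ⟨a, p, Walk.isHamiltonianCycle_iff_isCycle_and_support_count_tail_eq_one.2 ⟨?_, hcount⟩⟩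
  rw [Walk.isCycle_iff_isPath_tail_and_le_length]
  refine ⟨?_, by omega⟩
  rw [Walk.isPath_def, Walk.support_tail_of_not_nil]
  · exact List.nodup_iff_count_le_one.2 fun v => (hcount v).le
  · rw [← Walk.length_eq_zero_iff]
    omega

/-- A `t`-tough graph, `t > 1`, of minimum degree more than `n / (t + 1) - 1` is hamiltonian. -/
theorem IsTough.isHamiltonian [Fintype V] [DecidableEq V] [DecidableRel G.Adj] (ht : 1 < t)
    (hG : G.IsTough (ENNReal.ofReal t)) (hV : 3 ≤ Fintype.card V)
    (hδ : (Fintype.card V : ℝ) < (G.minDegree + 1) * (t + 1)) : G.IsHamiltonian := by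
  have hex : ∃ h, ∃ l, G.IsCyclicList l ∧ ∀ z ∉ l, (G.reach (offList l) z).ncard ≤ h := by
    obtain ⟨a, b, hab⟩ := hG.exists_adj (by linarith) (by omega)
    refine ⟨Fintype.card V, [a, b], ⟨by simp, by simpa using hab.ne, ?_⟩, fun z _ => ?_⟩
    · simpa [Cycle.chain_coe_cons] using ⟨hab, hab.symm⟩
    · rw [← Nat.card_eq_fintype_card]
      exact Set.ncard_le_card _
  classical
  rcases hfind : Nat.find hex with - | h
  · obtain ⟨l, hl, hlz⟩ := Nat.find_spec hex
    refine hl.isHamiltonian hV fun v => ?_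
    by_contra hv
    have h1 := hlz v hv
    rw [hfind, Nat.le_zero, Set.ncard_eq_zero] at h1
    exact (h1 ▸ mem_reach_self : v ∈ (∅ : Set V))
  · exfalso
    have h1 := Nat.find_spec hex
    rw [hfind] at h1
    obtain ⟨l, u, hl, hu, hI⟩ := exists_isUnimprovable h h1 (Nat.find_min hex (by omega))
    obtain ⟨hk, hn⟩ := hI.card_bounds ht hG hl hu
    have hd : ((G.minDegree : ℝ) + 1) ≤
        (({v | v ∈ l ∧ G.IsAttached l u v} : Set V).ncard : ℝ) +
          (G.reach (offList l) u).ncard := by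
      exact_mod_cast minDegree_lt_ncard_add_ncard hu
    have hr : (1 : ℝ) ≤ (G.reach (offList l) u).ncard := by
      exact_mod_cast (Set.ncard_pos (Set.toFinite _)).2 ⟨u, mem_reach_self⟩
    set k : ℝ := (({v | v ∈ l ∧ G.IsAttached l u v} : Set V).ncard : ℝ)
    set r : ℝ := ((G.reach (offList l) u).ncard : ℝ)
    have h2 : ((G.minDegree : ℝ) + 1) * (t + 1) ≤ (k + r) * (t + 1) :=
      mul_le_mul_of_nonneg_right hd (by linarith)
    -- This product equals (k+1)(t+r) - (k+r)(t+1).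
    have h3 : 0 ≤ (k - t) * (r - 1) := mul_nonneg (by linarith) (by linarith)
    linarith

end count

end SimpleGraph

lemma SimpleGraph.isHamiltonian_of_toughness_of_minDegree {V : Type*} [Fintype V] [DecidableEq V]
    {G : SimpleGraph V} [DecidableRel G.Adj] {a ε : ℝ} (hε : 0 < ε)
    (hV : 3 ≤ Fintype.card V) (hn : (4 * a - 2) / ε + 2 * a - 2 ≤ (Fintype.card V : ℝ))
    (hτ : ENNReal.ofReal (1 + ε) ≤ G.toughness)
    (hδ : (Fintype.card V : ℝ) / 2 - a ≤ (G.minDegree : ℝ)) : G.IsHamiltonian := by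
  refine (isTough_of_le_toughness hτ).isHamiltonian (by linarith) hV ?_
  have h1 : (Fintype.card V / 2 - a + 1) * (1 + ε + 1) ≤ ((G.minDegree : ℝ) + 1) * (1 + ε + 1) :=
    mul_le_mul_of_nonneg_right (by linarith) (by linarith)
  -- Half of this, added to n - 2a + 2, makes the left side of `h1` at least n + 1.
  have h2 : 4 * a - 2 ≤ (Fintype.card V - 2 * a + 2) * ε := by
    rw [← div_le_iff₀ hε]
    linarith
  linarith

theorem theorem1 (a : ℝ) (ha : 0 < a) (ε : ℝ) (hε : 0 < ε) :
    (∃ N : ℕ, ∀ (V : Type*) [Fintype V] [DecidableEq V] (G : SimpleGraph V) [DecidableRel G.Adj],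
      N ≤ Fintype.card V →
      ENNReal.ofReal (1 + ε) ≤ G.toughness →
      (Fintype.card V : ℝ) / 2 - a ≤ (G.minDegree : ℝ) →
      G.IsHamiltonian) ∧
    (∀ (V : Type*) [Fintype V] [DecidableEq V] (G : SimpleGraph V) [DecidableRel G.Adj],
      3 ≤ Fintype.card V →
      (4 * a - 2) / ε + 2 * a - 2 ≤ (Fintype.card V : ℝ) →
      ENNReal.ofReal (1 + ε) ≤ G.toughness →
      (Fintype.card V : ℝ) / 2 - a ≤ (G.minDegree : ℝ) →
      G.IsHamiltonian) := by
  refine ⟨⟨max 3 ⌈(4 * a - 2) / ε + 2 * a - 2⌉₊, fun V _ _ G _ hN hτ hδ => ?_⟩,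
    fun V _ _ G _ hV hn hτ hδ => ?_⟩
  · exact SimpleGraph.isHamiltonian_of_toughness_of_minDegree hε ((le_max_left _ _).trans hN)
      ((Nat.le_ceil _).trans (by exact_mod_cast (le_max_right _ _).trans hN)) hτ hδ
  · exact SimpleGraph.isHamiltonian_of_toughness_of_minDegree hε hV hn hτ hδ
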